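/- Let $n,k\ge 0$ and let $T^{n+k}=(S^1)^{n+k}$ act on $\mathbb{C}^n\times T^k\subset\mathbb{C}^{n+k}$ by coordinatewise multiplication (the $k$-standard action). A locally $k$-standard $T$-manifold is a $(2n+k)$-dimensional smooth manifold $M$ with a smooth effective $T^{n+k}$-action such that every $p\in M$ has a $T^{n+k}$-invariant open neighbourhood $U$ for which there exist an automorphism $\theta$ of the Lie group $T^{n+k}$ and a diffeomorphism $\varphi$ from $U$ onto an invariant open subset of $\mathbb{C}^n\times T^k$ satisfying $\varphi(t\cdot x)=\theta(t)\cdot\varphi(x)$ for all $t\in T^{n+k}$ and $x\in U$. Let $M$ be a locally $k$-standard $T$-manifold whose orbit space $M/T^{n+k}$ is, as a manifold with corners, an $n$-dimensional simple polytope $P$ with facets $F_1,\dots,F_m$; that is, there is a homeomorphism $M/T^{n+k}\cong P$ under which an orbit whose image in a chart $\varphi$ as above has exactly $r$ vanishing $\mathbb{C}$-coordinates corresponds to a point lying on exactly $r$ facets of $P$. Let $q\colon M\to P$ be the orbit map. For each $i$, the elements of $T^{n+k}$ fixing $q^{-1}(F_i)$ pointwise form a circle subgroup $T_i$. Let $\lambda\colon\{F_1,\dots,F_m\}\to\mathbb{Z}^{n+k}$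 be the characteristic function of $M$: $\lambda(F_i)=(\lambda_{i,1},\dots,\lambda_{i,n+k})$ is a primitive vector (unique up to sign) with $T_i=\{(s^{\lambda_{i,1}},\dots,s^{\lambda_{i,n+k}}) : s\in S^1\}$. If the submodule of $\mathbb{Z}^{n+k}$ generated by $\lambda(F_1),\dots,\lambda(F_m)$ has rank $n+k$, then the fundamental group $\pi_1(M)$ (at any base point) is a finite abelian group. -/

import Mathlib

open scoped Manifold ContDiff

noncomputable section

/-- The compact torus `T^d = (S¹)^d`, with Mathlib's product topology, group structure and
product charts. -/
abbrev Torus (d : ℕ) : Type := Fin d → Circle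

/-- The model with corners (without boundary) of the smooth manifold `T^d`. -/
abbrev torusModel (d : ℕ) :
    ModelWithCorners ℝ (Fin d → EuclideanSpace ℝ (Fin 1))
      (ModelPi fun _ : Fin d => EuclideanSpace ℝ (Fin 1)) :=
  ModelWithCorners.pi fun _ : Fin d => 𝓡 1

/-- The space `ℂⁿ × T^k`. -/
abbrev StdSpace (n k : ℕ) : Type := (Fin n → ℂ) × Torus k

/-- The model of `ℂⁿ × T^k` as a smooth (real) manifold. -/
abbrev stdModel (n k : ℕ) :
    ModelWithCorners ℝ ((Fin n → ℂ) × (Fin k → EuclideanSpace ℝ (Fin 1)))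
      (ModelProd (Fin n → ℂ) (ModelPi fun _ : Fin k => EuclideanSpace ℝ (Fin 1))) :=
  (𝓘(ℝ, Fin n → ℂ)).prod (torusModel k)

/-- The `k`-standard action of `T^{n+k}` on `ℂⁿ × T^k ⊆ ℂ^{n+k}`: coordinatewise
multiplication. -/
def stdAct {n k : ℕ} (t : Torus (n + k)) (z : StdSpace n k) : StdSpace n k :=
  (fun i => (t (Fin.castAdd k i) : ℂ) * z.1 i, fun j => t (Fin.natAdd n j) * z.2 j)

/-- A diffeomorphism from a `T^{n+k}`-invariant open subset of `M` onto an open subset of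
`ℂⁿ × T^k`, equivariant up to an automorphism `θ` of the Lie group `T^{n+k}`.
(The image is then automatically invariant, because `θ` is surjective.) -/
structure StdChart (n k : ℕ) (M : Type*) [TopologicalSpace M]
    [ChartedSpace (EuclideanSpace ℝ (Fin (2 * n + k))) M] [MulAction (Torus (n + k)) M] where
  /-- The underlying homeomorphism between open subsets. -/
  toHomeo : OpenPartialHomeomorph M (StdSpace n k)
  /-- The automorphism of the torus. -/
  θ : Torus (n + k) ≃ₜ* Torus (n + k)
  smul_mem : ∀ (t : Torus (n + k)), ∀ x ∈ toHomeo.source, t • x ∈ toHomeo.source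
  map_smul : ∀ (t : Torus (n + k)), ∀ x ∈ toHomeo.source,
    toHomeo (t • x) = stdAct (θ t) (toHomeo x)
  smooth : ContMDiffOn (𝓡 (2 * n + k)) (stdModel n k) ∞ toHomeo toHomeo.source
  smooth_symm : ContMDiffOn (stdModel n k) (𝓡 (2 * n + k)) ∞ toHomeo.symm toHomeo.target

/-- `M` is a locally `k`-standard `T`-manifold: a smooth effective `T^{n+k}`-action on a
`(2n+k)`-dimensional manifold, locally isomorphic to the `k`-standard action. -/
structure IsLocallyStandard (n k : ℕ) (M : Type*) [TopologicalSpace M]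
    [ChartedSpace (EuclideanSpace ℝ (Fin (2 * n + k))) M] [MulAction (Torus (n + k)) M] :
    Prop where
  smooth_action :
    ContMDiffSMul (torusModel (n + k)) (𝓡 (2 * n + k)) ∞ (Torus (n + k)) M
  effective : FaithfulSMul (Torus (n + k)) M
  locally_standard : ∀ p : M, ∃ c : StdChart n k M, p ∈ c.toHomeo.source

/-- The polyhedron `{x ∈ ℝⁿ | ⟨a i, x⟩ + b i ≥ 0 for all i}`. -/
def polyhedron {n m : ℕ} (a : Fin m → EuclideanSpace ℝ (Fin n)) (b : Fin m → ℝ) :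
    Set (EuclideanSpace ℝ (Fin n)) :=
  {x | ∀ i, 0 ≤ inner ℝ (a i) x + b i}

/-- The part of the polyhedron where the `i`-th inequality is an equality. -/
def polyhedronFace {n m : ℕ} (a : Fin m → EuclideanSpace ℝ (Fin n)) (b : Fin m → ℝ)
    (i : Fin m) : Set (EuclideanSpace ℝ (Fin n)) :=
  {x ∈ polyhedron a b | inner ℝ (a i) x + b i = 0}

/-- An `n`-dimensional simple convex polytope in `ℝⁿ` with facets `F_1, …, F_m`, given by its
irredundant system of inequalities, one for each facet. -/
structure SimplePolytope (n m : ℕ) where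
  /-- Inward normal vectors of the facets. -/
  a : Fin m → EuclideanSpace ℝ (Fin n)
  /-- Constant terms. -/
  b : Fin m → ℝ
  bounded : Bornology.IsBounded (polyhedron a b)
  full_dim : (interior (polyhedron a b)).Nonempty
  facet_nonempty : ∀ i, (polyhedronFace a b i).Nonempty
  /-- Each `F_i` has dimension `n - 1`. -/
  facet_dim : ∀ i, Module.finrank ℝ (vectorSpan ℝ (polyhedronFace a b i)) + 1 = n
  facet_injective : Function.Injective (polyhedronFace a b)
  /-- Each vertex lies in exactly `n` facets. -/
  simple : ∀ v ∈ Set.extremePoints ℝ (polyhedron a b),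
    {i | v ∈ polyhedronFace a b i}.ncard = n

/-- The underlying set of a simple polytope. -/
def SimplePolytope.carrier {n m : ℕ} (P : SimplePolytope n m) :
    Set (EuclideanSpace ℝ (Fin n)) := polyhedron P.a P.b

/-- The facet `F_i`. -/
def SimplePolytope.facet {n m : ℕ} (P : SimplePolytope n m) (i : Fin m) :
    Set (EuclideanSpace ℝ (Fin n)) := polyhedronFace P.a P.b i

/-- `q : M → P` is the orbit map of the torus action, the polytope `P` being the orbit space
as a manifold with corners: `q` induces a homeomorphism `M / T^{n+k} ≅ P`, and this
homeomorphism preserves codimension of faces. The point of `ℝⁿ_≥ = (ℂⁿ × T^k) / T^{n+k}` below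
`z` lies on as many coordinate hyperplanes as there are zeros among the `ℂ`-coordinates of `z`;
a point of a simple polytope has depth equal to the number of facets containing it. -/
structure IsOrbitMap {n k m : ℕ} {M : Type*} [TopologicalSpace M]
    [ChartedSpace (EuclideanSpace ℝ (Fin (2 * n + k))) M] [MulAction (Torus (n + k)) M]
    (P : SimplePolytope n m) (q : M → P.carrier) : Prop where
  isQuotientMap : Topology.IsQuotientMap q
  fiber : ∀ x y : M, q x = q y ↔ ∃ t : Torus (n + k), t • x = y
  depth : ∀ (c : StdChart n k M), ∀ x ∈ c.toHomeo.source,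
    {i | (q x : EuclideanSpace ℝ (Fin n)) ∈ P.facet i}.ncard =
      {j | (c.toHomeo x).1 j = 0}.ncard

/-- The one-parameter subgroup `S¹ → T^d`, `s ↦ (s^{v_1}, …, s^{v_d})`, of `v ∈ ℤ^d`. -/
def oneParam {d : ℕ} (v : Fin d → ℤ) : Circle →* Torus d where
  toFun s := fun j => s ^ v j
  map_one' := by ext j; simp
  map_mul' s t := by funext j; exact mul_zpow s t (v j)

/-- A vector of `ℤ^d` is primitive if its entries have no common divisor except `±1`. -/
def IsPrimitiveVector {d : ℕ} (v : Fin d → ℤ) : Prop :=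
  ∀ r : ℤ, (∀ j, r ∣ v j) → IsUnit r

/-- `lam` is the characteristic function of `M` over `P`: `lam i` is a primitive vector and
determines the circle `T_i`, the isotropy subgroup of `M_i = q⁻¹(F_i)`, i.e. the group of all
elements of the torus that fix `M_i` pointwise. (This determines `lam i` up to sign.) -/
def IsCharacteristicFunction {n k m : ℕ} {M : Type*} [MulAction (Torus (n + k)) M]
    (P : SimplePolytope n m) (q : M → P.carrier) (lam : Fin m → (Fin (n + k) → ℤ)) : Prop :=
  ∀ i, IsPrimitiveVector (lam i) ∧
    fixingSubgroup (Torus (n + k)) {x : M | (q x : EuclideanSpace ℝ (Fin n)) ∈ P.facet i} =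
      (oneParam (lam i)).range

/-- The rank of the submodule of `ℤ^d` generated by the values of `lam`. -/
def charRank {d m : ℕ} (lam : Fin m → (Fin d → ℤ)) : ℕ :=
  Module.finrank ℤ (Submodule.span ℤ (Set.range lam))

end

/-! Write `T` for the torus. The loops t ↦ exp(2πi t v) • x define a homomorphism from ℤ^{n+k} =
π₁(T) to π₁(M, x) (`orbitHom`). It is surjective and kills every λ(F_i); since these vectors span a
sublattice of full rank, hence of finite index, π₁(M, x) is a quotient of a finite abelian group.

Each λ(F_i) dies because its circle fixes some point y over F_i: sliding the base point along a path
from x to y shrinks the loop to a constant (`torusLoop_homotopic_refl`).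

Surjectivity says that every loop deforms into its orbit, and it rests on the convexity of P. Small
invariant tubes retract equivariantly onto orbits, so a short path with both ends in one orbit can
be pushed into that orbit. To globalise this without a section of q, let E be the set of homotopy
classes of paths from x, lying over P by the endpoint. A loop is a chain of short steps in E; over
each point of the chain, the class reached is compared with a lift of the straight segment from q(x)
(`IsNearness.of_reflTransGen`). At the end the segment is degenerate, so the loop differs from the
constant one only inside the orbit. Stabilizers being path connected, the resulting path in T can
then be closed up to a loop of T (`exists_homotopic_torusLoop`). -/

open scoped unitInterval

/-! ### Homotopies read off from squares -/

/-- Two continuous maps out of a simply connected space that agree on a path `η` send every other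
path with the same endpoints to homotopic paths. -/
theorem Path.homotopic_of_eqOn_range {A X : Type*} [TopologicalSpace A] [TopologicalSpace X]
    [SimplyConnectedSpace A] (K L : C(A, X)) {a b : A} (β η : Path a b)
    (h : Set.EqOn K L (Set.range η)) {x y : X} (γ δ : Path x y)
    (hγ : ∀ t, γ t = K (β t)) (hδ : ∀ t, δ t = L (β t)) : γ.Homotopic δ := by
  have hx : x = K a := by rw [← γ.source, hγ, β.source]
  have hy : y = K b := by rw [← γ.target, hγ, β.target]
  have hx' : x = L a := by rw [← δ.source, hδ, β.source]
  have hy' : y = L b := by rw [← δ.target, hδ, β.target]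
  have e1 : γ = (β.map K.continuous).cast hx hy := by ext t; simp [hγ]
  have e2 : δ = (β.map L.continuous).cast hx' hy' := by ext t; simp [hδ]
  have e3 : (η.map K.continuous).cast hx hy = (η.map L.continuous).cast hx' hy' := by
    ext t; simpa using h ⟨t, rfl⟩
  have H : β.Homotopic η := SimplyConnectedSpace.paths_homotopic β η
  have h1 : γ.Homotopic ((η.map K.continuous).cast hx hy) := by
    rw [e1]; exact (H.map K).pathCast hx hy
  have h2 : δ.Homotopic ((η.map L.continuous).cast hx' hy') := by
    rw [e2]; exact (H.map L).pathCast hx' hy'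
  rw [e3] at h1
  exact h1.trans h2.symm

theorem simplyConnectedSpace_unitInterval_prod : SimplyConnectedSpace (I × I) :=
  haveI : ContractibleSpace I := (convex_Icc (0 : ℝ) 1).contractibleSpace ⟨0, by simp⟩
  inferInstance

/-- If two squares agree on three of their sides, then the fourth sides are homotopic. -/
theorem Path.homotopic_of_squares {X : Type*} [TopologicalSpace X] (K L : C(I × I, X))
    (h₁ : ∀ t, K (1, t) = L (1, t)) (hl : ∀ s, K (s, 0) = L (s, 0))
    (hr : ∀ s, K (s, 1) = L (s, 1)) {x y : X} (γ δ : Path x y)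
    (hγ : ∀ t, γ t = K (0, t)) (hδ : ∀ t, δ t = L (0, t)) : γ.Homotopic δ := by
  have := simplyConnectedSpace_unitInterval_prod
  let up (b : I) : Path ((0, b) : I × I) (1, b) := ⟨⟨fun s => (s, b), by fun_prop⟩, rfl, rfl⟩
  let across (a : I) : Path ((a, 0) : I × I) (a, 1) := ⟨⟨fun s => (a, s), by fun_prop⟩, rfl, rfl⟩
  refine Path.homotopic_of_eqOn_range K L (across 0)
    (((up 0).trans (across 1)).trans (up 1).symm) (fun p hp => ?_) γ δ hγ hδ
  rw [Path.trans_range, Path.trans_range, Path.symm_range] at hp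
  obtain ((⟨s, rfl⟩ | ⟨s, rfl⟩) | ⟨s, rfl⟩) := hp
  exacts [hl s, h₁ s, hr s]

/-! ### Equivariant tubes around orbits -/

section Tube

variable {T X : Type*} [TopologicalSpace T] [CommGroup T]
  [TopologicalSpace X] [MulAction T X] [ContinuousSMul T X]

variable (T) in
/-- A path of the form `t ↦ g t • x`, where `g` is a path in the group starting at `1`. -/
def Path.IsOrbitPath {x y : X} (γ : Path x y) : Prop :=
  ∃ g : C(I, T), g 0 = 1 ∧ ∀ t, γ t = g t • x

variable (T) in
/-- An invariant open set that retracts equivariantly onto the orbit of one of its points, whose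
stabilizer is path connected. -/
structure IsTube (U : Set X) : Prop where
  isOpen : IsOpen U
  smul_mem : ∀ t : T, ∀ u ∈ U, t • u ∈ U
  exists_retraction : ∃ c : X, (∀ h : T, h • c = c → JoinedIn {t : T | t • c = c} 1 h) ∧
    ∃ (H : I × X → X) (ρ : X → T), ContinuousOn H (Set.univ ×ˢ U) ∧ ContinuousOn ρ U ∧
      (∀ u ∈ U, H (0, u) = u) ∧ (∀ u ∈ U, H (1, u) = ρ u • c) ∧
      (∀ s, ∀ u ∈ U, H (s, u) ∈ U) ∧ ∀ s, ∀ u ∈ U, ∀ t : T, H (s, t • u) = t • H (s, u)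

/-- The retraction turns γ into ρ(γ t) • c, a path in a single orbit. A path in the stabilizer of c
corrects its end, and the sides traced by the two endpoints agree with those of the flow of u moved
by the group. -/
theorem IsTube.exists_homotopic_isOrbitPath [IsTopologicalGroup T] {U : Set X} (hU : IsTube T U) {u v : X} {a : T}
    (hv : a • u = v) (γ : Path u v) (hγ : ∀ t, γ t ∈ U) :
    ∃ δ : Path u v, δ.IsOrbitPath T ∧ γ.Homotopic δ := by
  obtain ⟨c, hc, H, ρ, hH, hρ, H0, H1, -, Hsmul⟩ := hU.exists_retraction
  have huU : u ∈ U := by simpa using hγ 0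
  have hvU : v ∈ U := by simpa using hγ 1
  have hgc : Continuous fun t => ρ (γ t) := hρ.comp_continuous γ.continuous hγ
  -- Both a ρ(u) and ρ(v) carry c to the same point, so their quotient lies in the stabilizer of c.
  obtain ⟨s, hs⟩ := hc (a * ρ u * (ρ v)⁻¹) <| by
    have h1 : a • ρ u • c = ρ v • c := by
      rw [← H1 u huU, ← H1 v hvU, ← hv, Hsmul 1 u huU a]
    rw [mul_comm, mul_smul, mul_smul, h1, inv_smul_smul]
  let g : C(I, T) := ⟨fun t => ρ (γ t) * s t * (ρ u)⁻¹, (hgc.mul s.continuous).mul continuous_const⟩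
  have g0 : g 0 = 1 := by simp [g]
  have g1 : g 1 = a := by
    simp only [g, ContinuousMap.coe_mk, Path.target]
    rw [mul_comm a, mul_assoc (ρ u), mul_comm (ρ u), mul_assoc, mul_assoc, mul_assoc,
      mul_inv_cancel, mul_one, mul_comm a, mul_inv_cancel_left]
  have gc : ∀ t, g t • ρ u • c = ρ (γ t) • c := fun t => by
    have : s t • c = c := hs t
    rw [← mul_smul, show g t * ρ u = ρ (γ t) * s t from inv_mul_cancel_right _ _, mul_smul, this]
  -- K flows the whole path γ; L flows only u and moves the result by g. They agree at flow time 1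
  -- and, by equivariance, over both ends of γ.
  let K : C(I × I, X) := ⟨fun p => H (p.1, γ p.2),
    hH.comp_continuous (by fun_prop) fun p => ⟨trivial, hγ _⟩⟩
  let L : C(I × I, X) := ⟨fun p => g p.2 • H (p.1, u),
    ((g.continuous.comp continuous_snd).smul
      (hH.comp_continuous (by fun_prop) fun p => ⟨trivial, huU⟩))⟩
  let δ : Path u v := ⟨⟨fun t => g t • u, by fun_prop⟩, by simp [g0], by simp [g1, hv]⟩
  refine ⟨δ, ⟨g, g0, fun t => rfl⟩, Path.homotopic_of_squares K L ?_ ?_ ?_ γ δ ?_ ?_⟩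
  · intro t
    simp only [K, L, ContinuousMap.coe_mk]
    rw [H1 _ (hγ t), H1 u huU, gc]
  · intro r
    simp [K, L, g0]
  · intro r
    simp only [K, L, ContinuousMap.coe_mk, g1, Path.target]
    rw [← hv, Hsmul r u huU]
  · intro t
    simp [K, H0 _ (hγ t)]
  · intro t
    simp [L, δ, H0 _ huU]

theorem IsTube.joinedIn [PathConnectedSpace T] {U : Set X} (hU : IsTube T U) {u v : X}
    (hu : u ∈ U) (hv : v ∈ U) : JoinedIn U u v := by
  obtain ⟨c, -, H, ρ, hH, -, H0, H1, HU, -⟩ := hU.exists_retraction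
  have key : ∀ w ∈ U, JoinedIn U w (ρ w • c) := fun w hw =>
    ⟨⟨⟨fun s => H (s, w), hH.comp_continuous (by fun_prop) fun p => ⟨trivial, hw⟩⟩,
      by simp [H0 w hw], by simp [H1 w hw]⟩, fun s => HU s w hw⟩
  have hcU : c ∈ U := by
    have := hU.smul_mem (ρ u)⁻¹ _ (H1 u hu ▸ HU 1 u hu)
    rwa [inv_smul_smul] at this
  have mid : JoinedIn U (ρ u • c) (ρ v • c) := by
    let p := PathConnectedSpace.somePath (ρ u) (ρ v)
    exact ⟨p.map (f := fun t => t • c) (by fun_prop), fun t => hU.smul_mem _ _ hcU⟩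
  exact ((key u hu).trans mid).trans (key v hv).symm

end Tube

/-! ### Lifting segments through a nearness relation -/

section Chains

variable {E V : Type*} [NormedAddCommGroup V] [NormedSpace ℝ V]

/-- Relations `N r` on the total space of a map `π : E → V` with image in `C`, to be thought of as
`being joined by a path which stays within distance r`. Short paths can be lifted, and the short
paths with endpoints in the same fibre can be shrunk into that fibre. -/
structure IsNearness (π : E → V) (C : Set V) (N : ℝ → E → E → Prop) (η δ : ℝ) : Prop where
  mem : ∀ e, π e ∈ C
  pos : 0 < η
  refl : ∀ e, N 0 e e
  symm : ∀ {r e f}, N r e f → N (2 * r) f e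
  trans : ∀ {r s e f g}, N r e f → N s f g → N (r + s) e g
  mono : ∀ {r s e f}, r ≤ s → N r e f → N s e f
  dist_le : ∀ {r e f}, N r e f → dist (π e) (π f) ≤ r
  close : ∀ {e f}, N (8 * η) e f → π e = π f → N 0 e f
  lift : ∀ e, ∀ p ∈ C, dist (π e) p < δ → ∃ f, π f = p ∧ N η e f

/-- The points reached from `e₀` after `j` steps of a lift of the segment from `π e₀` to `p`, cut
into `K` equal parts. -/
def segmentLift (π : E → V) (N : ℝ → E → E → Prop) (η : ℝ) (e₀ : E) (K : ℕ) (p : V) : ℕ → Set E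
  | 0 => {e₀}
  | j + 1 => {f | π f = AffineMap.lineMap (π e₀) p (((j + 1 : ℕ) : ℝ) / K) ∧
      ∃ e ∈ segmentLift π N η e₀ K p j, N η e f}

variable {π : E → V} {C : Set V} {N : ℝ → E → E → Prop} {η δ : ℝ} {e₀ : E} {K : ℕ}

theorem proj_of_mem_segmentLift {p : V} {j : ℕ} {e : E}
    (he : e ∈ segmentLift π N η e₀ K p j) :
    π e = AffineMap.lineMap (π e₀) p ((j : ℝ) / K) := by
  cases j with
  | zero => simp [show e = e₀ from he]
  | succ j => exact he.1

theorem lineMap_div_mem (hC : Convex ℝ C) {c p : V} (hc : c ∈ C) (hp : p ∈ C) {j : ℕ}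
    (hj : j ≤ K) : AffineMap.lineMap c p ((j : ℝ) / K) ∈ C :=
  hC.lineMap_mem hc hp ⟨by positivity, div_le_one_of_le₀ (by exact_mod_cast hj) (by positivity)⟩

theorem IsNearness.segmentLift_nonempty (h : IsNearness π C N η δ) (hC : Convex ℝ C) {p : V}
    (hp : p ∈ C) (hK : dist (π e₀) p / K < δ) {j : ℕ} (hj : j ≤ K) :
    (segmentLift π N η e₀ K p j).Nonempty := by
  induction j with
  | zero => exact ⟨e₀, rfl⟩
  | succ j ih =>
    obtain ⟨e, he⟩ := ih (by omega)
    obtain ⟨f, hf, hef⟩ := h.lift e _ (lineMap_div_mem hC (h.mem e₀) hp hj) <| by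
      rw [proj_of_mem_segmentLift he, dist_lineMap_lineMap, Real.dist_eq, ← sub_div]
      have : |((j : ℝ) - ((j + 1 : ℕ) : ℝ)) / K| = 1 / K := by
        push_cast
        rw [sub_add_cancel_left, abs_div, abs_neg, abs_one, Nat.abs_cast]
      rw [this, one_div, inv_mul_eq_div]
      exact hK
    exact ⟨f, hf, e, he, hef⟩

/-- Lifts of two nearby segments stay close at every step: their points over corresponding
parameters have distance below δ, and `close` keeps the error from accumulating. -/
theorem IsNearness.segmentLift_compare (h : IsNearness π C N η δ) {p p' : V}
    (hpp : dist p p' < δ) {j : ℕ} (hj : j ≤ K) {e e' : E}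
    (he : e ∈ segmentLift π N η e₀ K p j) (he' : e' ∈ segmentLift π N η e₀ K p' j) :
    ∃ e'', N η e e'' ∧ N 0 e'' e' := by
  induction j generalizing e e' with
  | zero =>
    obtain rfl : e = e₀ := he
    obtain rfl : e' = e := he'
    exact ⟨e', h.mono h.pos.le (h.refl _), h.refl _⟩
  | succ j ih =>
    have hd : dist (π e) (π e') < δ := by
      rw [proj_of_mem_segmentLift he, proj_of_mem_segmentLift he']
      refine lt_of_le_of_lt ?_ hpp
      simp only [AffineMap.lineMap_apply, vsub_eq_sub, vadd_eq_add, dist_add_right]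
      rw [dist_smul₀, dist_sub_right, Real.norm_eq_abs, abs_of_nonneg (by positivity)]
      exact mul_le_of_le_one_left dist_nonneg
        (div_le_one_of_le₀ (by exact_mod_cast hj) (by positivity))
    obtain ⟨f'', hf'', hef''⟩ := h.lift e _ (h.mem e') hd
    obtain ⟨-, a, ha, hae⟩ := he
    obtain ⟨-, a', ha', hae'⟩ := he'
    obtain ⟨a'', haa'', ha''⟩ := ih (by omega) ha ha'
    -- The detour costs 2η + 2η + η + 0 + η = 6η, since reversal doubles the radius; this is within
    -- the 8η allowed by `close`.
    refine ⟨f'', hef'', h.close (h.mono ?_ (h.trans (h.symm hef'') (h.trans (h.symm hae)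
      (h.trans haa'' (h.trans ha'' hae'))))) hf''⟩
    linarith [h.pos]

/-- Convexity keeps the straight segments to the points of the chain inside C. Their lifts follow
the chain up to the fibre, and when the chain returns to its starting fibre the segment is constant.
-/
theorem IsNearness.of_reflTransGen (h : IsNearness π C N η δ) (hδ : 0 < δ) (hC : Convex ℝ C)
    (hb : Bornology.IsBounded C) {ρ : ℝ} (hρη : ρ ≤ η) (hρδ : ρ < δ) {f : E}
    (hf : Relation.ReflTransGen (N ρ) e₀ f) (hπ : π f = π e₀) : N 0 e₀ f := by
  obtain ⟨R, hR⟩ := Metric.isBounded_iff.1 hb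
  obtain ⟨K, hK⟩ := exists_nat_gt (R / δ)
  have hR0 : 0 ≤ R := dist_nonneg.trans (hR (h.mem e₀) (h.mem e₀))
  have hK0 : (0 : ℝ) < K := lt_of_le_of_lt (by positivity) hK
  have hne : ∀ p ∈ C, (segmentLift π N η e₀ K p K).Nonempty := fun p hp =>
    h.segmentLift_nonempty hC hp (by
      rw [div_lt_iff₀ hK0]
      rw [div_lt_iff₀ hδ] at hK
      exact lt_of_le_of_lt (hR (h.mem e₀) hp) (by rwa [mul_comm])) le_rfl
  have hproj : ∀ {p g}, g ∈ segmentLift π N η e₀ K p K → π g = p := fun {p g} hg => by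
    rw [proj_of_mem_segmentLift hg, div_self hK0.ne', AffineMap.lineMap_apply_one]
  have hconst : ∀ j, e₀ ∈ segmentLift π N η e₀ K (π e₀) j := fun j => by
    induction j with
    | zero => rfl
    | succ j ih =>
      exact ⟨by simp, e₀, ih, h.mono h.pos.le (h.refl _)⟩
  -- Induction along the chain, for all lifts at once; the hypothesis on the final fibre is dropped
  -- because intermediate points do not satisfy it.
  have key : ∀ g ∈ segmentLift π N η e₀ K (π f) K, N 0 f g := by
    clear hπ
    induction hf with
    | refl =>
      intro g hg
      obtain ⟨e'', h1, h2⟩ := h.segmentLift_compare (by simpa using hδ) le_rfl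
        (hconst K) hg
      exact h.close (h.mono (by linarith [h.pos]) (h.trans h1 h2)) (hproj hg).symm
    | @tail a b _ hab ih =>
      intro g hg
      obtain ⟨e, he⟩ := hne (π a) (h.mem a)
      obtain ⟨e'', h1, h2⟩ := h.segmentLift_compare
        (lt_of_le_of_lt (h.dist_le hab) hρδ) le_rfl he hg
      exact h.close (h.mono (by linarith [h.pos])
        (h.trans (h.symm hab) (h.trans (ih e he) (h.trans h1 h2)))) (hproj hg).symm
  have h0 := h.symm (key e₀ (hπ ▸ hconst K))
  simpa using h0

end Chains

/-! ### Homotopy classes of paths over a convex orbit space -/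

section OrbitPaths

variable {X V : Type*} [TopologicalSpace X] [NormedAddCommGroup V]

/-- Two homotopy classes of paths issuing from `x` differ by a path whose image in `V` stays
within distance `r` of its starting point. -/
def PathNear (q : X → V) (x : X) (r : ℝ) (e f : Σ y, Path.Homotopic.Quotient x y) : Prop :=
  ∃ β : Path e.1 f.1, (∀ t, dist (q (β t)) (q e.1) ≤ r) ∧
    f.2 = e.2.trans (Path.Homotopic.Quotient.mk β)

theorem PathNear.refl {q : X → V} {x : X} (e : Σ y, Path.Homotopic.Quotient x y) :
    PathNear q x 0 e e :=
  ⟨Path.refl _, by simp, by simp⟩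

theorem PathNear.mono {q : X → V} {x : X} {r s : ℝ} (h : r ≤ s)
    {e f : Σ y, Path.Homotopic.Quotient x y} (hef : PathNear q x r e f) : PathNear q x s e f := by
  obtain ⟨β, hβ, he⟩ := hef
  exact ⟨β, fun t => (hβ t).trans h, he⟩

theorem PathNear.dist_le {q : X → V} {x : X} {r : ℝ} {e f : Σ y, Path.Homotopic.Quotient x y}
    (hef : PathNear q x r e f) : dist (q e.1) (q f.1) ≤ r := by
  obtain ⟨β, hβ, -⟩ := hef
  simpa [dist_comm] using hβ 1

theorem PathNear.symm {q : X → V} {x : X} {r : ℝ} {e f : Σ y, Path.Homotopic.Quotient x y}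
    (hef : PathNear q x r e f) : PathNear q x (2 * r) f e := by
  have hd := hef.dist_le
  obtain ⟨β, hβ, he⟩ := hef
  refine ⟨β.symm, fun t => ?_, ?_⟩
  · have := dist_triangle (q (β.symm t)) (q e.1) (q f.1)
    have h2 : dist (q (β.symm t)) (q e.1) ≤ r := hβ _
    linarith
  · rw [he]; simp

theorem PathNear.trans {q : X → V} {x : X} {r s : ℝ} {e f g : Σ y, Path.Homotopic.Quotient x y}
    (hef : PathNear q x r e f) (hfg : PathNear q x s f g) : PathNear q x (r + s) e g := by
  have hd := hef.dist_le
  have hd' := hfg.dist_le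
  obtain ⟨β, hβ, he⟩ := hef
  obtain ⟨β', hβ', he'⟩ := hfg
  have hs : 0 ≤ s := dist_nonneg.trans hd'
  refine ⟨β.trans β', fun t => ?_, ?_⟩
  · have ht : (β.trans β') t ∈ Set.range β ∪ Set.range β' := by
      rw [← Path.trans_range]; exact ⟨t, rfl⟩
    rcases ht with ⟨u, hu⟩ | ⟨u, hu⟩
    · rw [← hu]; linarith [hβ u]
    · rw [← hu]
      have := dist_triangle (q (β' u)) (q f.1) (q e.1)
      rw [dist_comm (q f.1)] at this
      linarith [hβ' u]
  · rw [he', he]; simp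

/-- The homotopy class of the restriction of a path to `[0, t]`. -/
noncomputable def initialClass (γ : C(I, X)) (t : I) : Σ y, Path.Homotopic.Quotient (γ 0) y :=
  have : ContractibleSpace I := (convex_Icc (0 : ℝ) 1).contractibleSpace ⟨0, by simp⟩
  ⟨γ t, (Path.Homotopic.Quotient.mk (PathConnectedSpace.somePath 0 t)).map γ⟩

/-- The interval is simply connected, so any path from 0 to t computes the class. -/
theorem initialClass_eq (γ : C(I, X)) {t : I} (p : Path 0 t) :
    initialClass γ t = ⟨γ t, Path.Homotopic.Quotient.mk (p.map γ.continuous)⟩ := by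
  have : ContractibleSpace I := (convex_Icc (0 : ℝ) 1).contractibleSpace ⟨0, by simp⟩
  rw [Path.Homotopic.Quotient.mk_map]
  exact congrArg (fun z => (⟨γ t, Path.Homotopic.Quotient.map z γ⟩ :
    Σ y, Path.Homotopic.Quotient (γ 0) y)) (Subsingleton.elim _ _)

theorem initialClass_zero (γ : C(I, X)) :
    initialClass γ 0 = ⟨γ 0, Path.Homotopic.Quotient.refl (γ 0)⟩ :=
  initialClass_eq γ (Path.refl 0)

theorem initialClass_one (γ : C(I, X)) :
    initialClass γ 1 =
      ⟨γ 1, Path.Homotopic.Quotient.mk (⟨γ, rfl, rfl⟩ : Path (γ 0) (γ 1))⟩ :=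
  initialClass_eq γ (⟨ContinuousMap.id I, rfl, rfl⟩ : Path (0 : I) 1)

theorem reflTransGen_initialClass {q : X → V} (hq : Continuous q) (γ : C(I, X)) {ρ : ℝ}
    (hρ : 0 < ρ) :
    Relation.ReflTransGen (PathNear q (γ 0) ρ) (initialClass γ 0) (initialClass γ 1) := by
  have huc : UniformContinuous fun t => q (γ t) :=
    CompactSpace.uniformContinuous_of_continuous (by fun_prop)
  obtain ⟨ε, hε, hd⟩ := Metric.uniformContinuous_iff.1 huc ρ hρ
  obtain ⟨n, hn⟩ := exists_nat_one_div_lt hε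
  have hstep : ∀ s t : I, dist s t < ε →
      PathNear q (γ 0) ρ (initialClass γ s) (initialClass γ t) := by
    intro s t hst
    let β : Path s t :=
      ⟨⟨fun u => ⟨AffineMap.lineMap (s : ℝ) (t : ℝ) (u : ℝ),
          (convex_Icc (0 : ℝ) 1).lineMap_mem s.2 t.2 u.2⟩,
        Continuous.subtype_mk (by fun_prop) _⟩, by simp, by simp⟩
    have : ContractibleSpace I := (convex_Icc (0 : ℝ) 1).contractibleSpace ⟨0, by simp⟩
    -- The path to t is chosen to run through s, so the second class is visibly the first one
    -- extended by β.
    rw [initialClass_eq γ (PathConnectedSpace.somePath 0 s),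
      initialClass_eq γ ((PathConnectedSpace.somePath 0 s).trans β)]
    refine ⟨β.map γ.continuous, fun u => (hd ?_).le, ?_⟩
    · rw [Subtype.dist_eq]
      change dist (AffineMap.lineMap (s : ℝ) (t : ℝ) (u : ℝ)) (s : ℝ) < ε
      rw [dist_lineMap_left, Real.norm_eq_abs, abs_of_nonneg u.2.1]
      exact lt_of_le_of_lt (mul_le_of_le_one_left dist_nonneg u.2.2) hst
    · rw [Path.map_trans, Path.Homotopic.Quotient.mk_trans]
  let t : ℕ → I := fun i => Set.projIcc 0 1 zero_le_one ((i : ℝ) * (1 / ((n : ℝ) + 1)))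
  have hchain : ∀ i, Relation.ReflTransGen (PathNear q (γ 0) ρ) (initialClass γ (t 0))
      (initialClass γ (t i)) := fun i => by
    induction i with
    | zero => exact .refl
    | succ i ih =>
      refine ih.tail (hstep _ _ (lt_of_le_of_lt ?_ hn))
      refine (Set.abs_projIcc_sub_projIcc _).trans ?_
      push_cast
      rw [← sub_mul, sub_add_cancel_left, abs_mul, abs_neg, abs_one, one_mul, abs_of_pos]
      positivity
  have h0 : t 0 = 0 := by simp [t]
  have h1 : t (n + 1) = 1 := by
    have : (((n + 1 : ℕ) : ℝ) * (1 / ((n : ℝ) + 1))) = 1 := by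
      push_cast; field_simp
    simp only [t, this]
    exact Set.projIcc_right _
  simpa [h0, h1] using hchain (n + 1)

variable {T : Type*} [TopologicalSpace T] [CommGroup T] [MulAction T X]

/-- Invariant open sets are saturated for q, so tubes have open images; a Lebesgue number for this
cover of the compact C gives δ. -/
theorem exists_forall_dist_lt_mem_tube {C : Set V} (hC : IsCompact C) {q : X → C}
    (hq : Topology.IsQuotientMap q) (hfib : ∀ x y : X, q x = q y ↔ ∃ t : T, t • x = y)
    (P : X → Set X → Prop) (h : ∀ x, ∃ U, IsTube T U ∧ x ∈ U ∧ P x U) :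
    ∃ δ > 0, ∀ y, ∃ x U, IsTube T U ∧ P x U ∧ ∀ z, dist (q z : V) (q y) < δ → z ∈ U := by
  choose U hU hxU hP using h
  have hpre : ∀ x z, q z ∈ q '' U x → z ∈ U x := by
    rintro x z ⟨w, hw, hwz⟩
    obtain ⟨t, rfl⟩ := (hfib w z).1 hwz
    exact (hU x).smul_mem t w hw
  have hopen : ∀ x, IsOpen (q '' U x) := fun x => by
    rw [← hq.isOpen_preimage]
    convert (hU x).isOpen
    exact Set.Subset.antisymm (hpre x) (Set.subset_preimage_image _ _)
  have : CompactSpace C := isCompact_iff_compactSpace.1 hC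
  obtain ⟨δ, hδ, hleb⟩ := lebesgue_number_lemma_of_metric (isCompact_univ (X := C)) hopen
    (fun p _ => by
      obtain ⟨x, rfl⟩ := hq.surjective p
      exact Set.mem_iUnion.2 ⟨x, x, hxU x, rfl⟩)
  refine ⟨δ, hδ, fun y => ?_⟩
  obtain ⟨x, hx⟩ := hleb (q y) trivial
  exact ⟨x, U x, hU x, hP x, fun z hz => hpre x z (hx hz)⟩

variable [IsTopologicalGroup T] [PathConnectedSpace T] [ContinuousSMul T X]

/-- Two scales are needed. First η is fixed so that a path within 8η of its start lies in one tube
and can be pushed into an orbit. Then δ comes from tubes so thin over C that joining points inside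
one never leaves radius η. -/
theorem exists_isNearness {C : Set V} (hC : IsCompact C) {q : X → C}
    (hq : Topology.IsQuotientMap q) (hfib : ∀ x y : X, q x = q y ↔ ∃ t : T, t • x = y)
    (h : ∀ x (W : Set X), IsOpen W → x ∈ W → (∀ t : T, ∀ w ∈ W, t • w ∈ W) →
      ∃ U, IsTube T U ∧ x ∈ U ∧ U ⊆ W) :
    ∃ η > 0, ∃ δ > 0, ∀ x : X,
      IsNearness (fun e : Σ y, Path.Homotopic.Quotient x y => (q e.1 : V)) C
        (PathNear (fun y => (q y : V)) x) η δ := by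
  have hinv : ∀ (t : T) w, q (t • w) = q w := fun t w => ((hfib w _).2 ⟨t, rfl⟩).symm
  obtain ⟨δ₁, hδ₁, H₁⟩ := exists_forall_dist_lt_mem_tube (T := T) hC hq hfib (fun _ _ => True)
    fun x => by
      obtain ⟨U, hU, hx, -⟩ := h x Set.univ isOpen_univ trivial (fun _ _ _ => trivial)
      exact ⟨U, hU, hx, trivial⟩
  obtain ⟨η, hη, hηδ⟩ : ∃ η > 0, 8 * η < δ₁ := ⟨δ₁ / 16, by positivity, by linarith⟩
  obtain ⟨δ, hδ, H₂⟩ := exists_forall_dist_lt_mem_tube (T := T) hC hq hfib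
    (fun x U => U ⊆ {z | dist (q z : V) (q x) < η / 2}) fun x => by
      refine h x _ ?_ (by simpa using hη) fun t w hw => by simpa [hinv] using hw
      have := hq.continuous
      exact isOpen_lt (by fun_prop) continuous_const
  refine ⟨η, hη, δ, hδ, fun x => ⟨fun e => (q e.1).2, hη, PathNear.refl, PathNear.symm,
    PathNear.trans, fun hrs hef => hef.mono hrs, PathNear.dist_le, ?_, ?_⟩⟩
  · rintro ⟨y, α⟩ ⟨z, α'⟩ ⟨β, hβ, hα'⟩ hyz
    obtain ⟨-, U, hU, -, hyU⟩ := H₁ y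
    obtain ⟨a, ha⟩ := (hfib y z).1 (Subtype.ext hyz)
    obtain ⟨ε, ⟨g, -, hg⟩, hβε⟩ := hU.exists_homotopic_isOrbitPath ha β
      fun t => hyU _ ((hβ t).trans_lt hηδ)
    refine ⟨ε, fun t => ?_, ?_⟩
    · simp [hg, hinv]
    · rw [hα', Path.Homotopic.Quotient.eq.2 hβε]
  · rintro ⟨y, α⟩ p hp hyp
    obtain ⟨z, hz⟩ := hq.surjective ⟨p, hp⟩
    obtain ⟨c, U, hU, hcU, hyU⟩ := H₂ y
    have hyy : y ∈ U := hyU y (by simpa using hδ)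
    obtain ⟨β, hβ⟩ := hU.joinedIn hyy (hyU z (by rw [hz, dist_comm]; exact hyp))
    refine ⟨⟨z, α.trans (Path.Homotopic.Quotient.mk β)⟩, by simp [hz], β, fun t => ?_, rfl⟩
    have h1 : dist (q (β t) : V) (q c) < η / 2 := hcU (hβ t)
    have h2 : dist (q y : V) (q c) < η / 2 := hcU hyy
    have := dist_triangle_right (q (β t) : V) (q y) (q c)
    exact (by linarith : dist (q (β t) : V) (q y) ≤ η)

variable [NormedSpace ℝ V]

/-- Over a compact convex orbit space, if the orbits have arbitrarily small tubes, then every path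
whose endpoints lie in one orbit is homotopic to a path in that orbit induced by a path in the
group. -/
theorem exists_homotopic_isOrbitPath_of_tubes {C : Set V} (hC : IsCompact C) (hconv : Convex ℝ C)
    {q : X → C}
    (hq : Topology.IsQuotientMap q) (hfib : ∀ x y : X, q x = q y ↔ ∃ t : T, t • x = y)
    (h : ∀ x (W : Set X), IsOpen W → x ∈ W → (∀ t : T, ∀ w ∈ W, t • w ∈ W) →
      ∃ U, IsTube T U ∧ x ∈ U ∧ U ⊆ W) {x y : X} (γ : Path x y) (hxy : q x = q y) :
    ∃ ε : Path x y, ε.IsOrbitPath T ∧ γ.Homotopic ε := by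
  obtain ⟨η, hη, δ, hδ, H⟩ := exists_isNearness hC hq hfib h
  have hcont : Continuous fun y => (q y : V) := continuous_subtype_val.comp hq.continuous
  have hρ : 0 < min η δ / 2 := by positivity
  have hchain := reflTransGen_initialClass hcont (γ : C(I, X)) hρ
  have h0 := (H (γ 0)).of_reflTransGen hδ hconv hC.isBounded
    (by linarith [min_le_left η δ]) (by linarith [min_le_right η δ]) hchain
    (by
      change (q (γ 1) : V) = q (γ 0)
      rw [γ.source, γ.target, hxy])
  rw [initialClass_zero, initialClass_one] at h0
  obtain ⟨β, hβ, hβγ⟩ := h0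
  -- Radius 0 puts β inside one orbit, but does not yet write it as g(t) • x; a tube around that
  -- orbit supplies g.
  obtain ⟨U, hU, hxU, -⟩ := h (γ 0) Set.univ isOpen_univ trivial (fun _ _ _ => trivial)
  obtain ⟨a, ha⟩ := (hfib (γ 0) (γ 1)).1 (by rw [γ.source, γ.target, hxy])
  obtain ⟨ε, ⟨g, hg0, hg⟩, hβε⟩ := hU.exists_homotopic_isOrbitPath ha β fun t => by
    have := dist_le_zero.1 (hβ t)
    obtain ⟨s, hs⟩ := (hfib (γ 0) (β t)).1 (Subtype.ext this.symm)
    exact hs ▸ hU.smul_mem s _ hxU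
  refine ⟨ε.cast γ.source.symm γ.target.symm, ⟨g, hg0, fun t => ?_⟩, ?_⟩
  · rw [Path.cast_coe, hg, γ.source]
  · have h1 := Path.Homotopic.Quotient.eq.1 (hβγ.trans (Path.Homotopic.Quotient.refl_trans _))
    exact (h1.trans hβε).pathCast γ.source.symm γ.target.symm

/-- Lifting the segment from q(x) to q(y) reaches the orbit of y, and path connectedness of T
finishes. -/
theorem joined_of_tubes {C : Set V} (hC : IsCompact C) (hconv : Convex ℝ C) {q : X → C}
    (hq : Topology.IsQuotientMap q) (hfib : ∀ x y : X, q x = q y ↔ ∃ t : T, t • x = y)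
    (h : ∀ x (W : Set X), IsOpen W → x ∈ W → (∀ t : T, ∀ w ∈ W, t • w ∈ W) →
      ∃ U, IsTube T U ∧ x ∈ U ∧ U ⊆ W) (x y : X) : Joined x y := by
  obtain ⟨η, hη, δ, hδ, H⟩ := exists_isNearness hC hq hfib h
  obtain ⟨K, hK⟩ := exists_nat_gt (dist (q x : V) (q y) / δ)
  have hK0 : (0 : ℝ) < K := lt_of_le_of_lt (by positivity) hK
  obtain ⟨e, he⟩ := (H x).segmentLift_nonempty
    (e₀ := (⟨x, Path.Homotopic.Quotient.refl x⟩ : Σ y, Path.Homotopic.Quotient x y))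
    hconv (q y).2 (by rwa [div_lt_comm₀ hK0 hδ]) le_rfl
  have hey := proj_of_mem_segmentLift he
  rw [div_self hK0.ne', AffineMap.lineMap_apply_one] at hey
  obtain ⟨t, ht⟩ := (hfib e.1 y).1 (Subtype.ext hey)
  have h2 : Joined e.1 y :=
    ⟨((PathConnectedSpace.somePath 1 t).map (f := fun t => t • e.1) (by fun_prop)).cast
      (one_smul T e.1).symm ht.symm⟩
  exact Joined.trans ⟨e.2.out⟩ h2

end OrbitPaths

/-! ### Loops induced by the torus -/

/-- A homotopy between two paths in a simply connected space is transported by any map. -/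
theorem Path.homotopic_of_comp {A X : Type*} [TopologicalSpace A] [TopologicalSpace X]
    [SimplyConnectedSpace A] (f : C(A, X)) {a b : A} (β η : Path a b) {x y : X} (γ δ : Path x y)
    (hγ : ∀ t, γ t = f (β t)) (hδ : ∀ t, δ t = f (η t)) : γ.Homotopic δ := by
  have hx : x = f a := by rw [← γ.source, hγ, β.source]
  have hy : y = f b := by rw [← γ.target, hγ, β.target]
  have e1 : γ = (β.map f.continuous).cast hx hy := by ext t; simp [hγ]
  have e2 : δ = (η.map f.continuous).cast hx hy := by ext t; simp [hδ]
  rw [e1, e2]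
  exact ((SimplyConnectedSpace.paths_homotopic β η).map f).pathCast hx hy

section TorusLoops

variable {d : ℕ}

/-- The universal covering `ℝ^d → T^d`, with kernel `ℤ^d`. -/
noncomputable def torusExp (d : ℕ) : C(Fin d → ℝ, Torus d) where
  toFun u i := Circle.exp (2 * Real.pi * u i)
  continuous_toFun := by fun_prop

theorem torusExp_add (u v : Fin d → ℝ) : torusExp d (u + v) = torusExp d u * torusExp d v := by
  funext i
  simp [torusExp, mul_add, Circle.exp_add]

theorem torusExp_zero : torusExp d 0 = 1 := by
  funext i
  simp [torusExp]

theorem torusExp_surjective (d : ℕ) : Function.Surjective (torusExp d) := fun t => by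
  choose r hr using fun i => Circle.exp_surjective (t i)
  have := Real.pi_ne_zero
  refine ⟨fun i => r i / (2 * Real.pi), funext fun i => ?_⟩
  rw [← hr i]
  simp only [torusExp, ContinuousMap.coe_mk]
  congr 1
  field_simp

theorem torusExp_intCast (v : Fin d → ℤ) : torusExp d (fun i => (v i : ℝ)) = 1 := by
  funext i
  exact Circle.exp_two_pi_mul_int (v i)

theorem torusExp_mul_intCast (r : ℝ) (v : Fin d → ℤ) :
    torusExp d (fun i => r * v i) = oneParam v (Circle.exp (2 * Real.pi * r)) := by
  funext i
  change Circle.exp (2 * Real.pi * (r * v i)) = Circle.exp (2 * Real.pi * r) ^ v i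
  rw [← Circle.exp_intCast_mul]
  congr 1
  ring

theorem exists_lift_torusExp (g : C(I, Torus d)) (h0 : g 0 = 1) (h1 : g 1 = 1) :
    ∃ (v : Fin d → ℤ) (G : Path (0 : Fin d → ℝ) (fun i => (v i : ℝ))),
      ∀ t, torusExp d (G t) = g t := by
  have lift : ∀ i, ∃ Γ : C(I, ℝ), Circle.exp ∘ Γ = (fun t => g t i) ∧ Γ 0 = 0 := fun i =>
    Circle.isCoveringMap_exp.exists_path_lifts ⟨fun t => g t i, by fun_prop⟩ 0 (by simp [h0])
  choose Γ hΓ hΓ0 using lift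
  have hend : ∀ i, ∃ n : ℤ, Γ i 1 = n * (2 * Real.pi) := fun i => by
    rw [← Circle.exp_eq_one]
    simpa [h1] using congrFun (hΓ i) 1
  choose v hv using hend
  refine ⟨v, ⟨⟨fun t i => Γ i t / (2 * Real.pi), by fun_prop⟩, ?_, ?_⟩, fun t => ?_⟩
  · funext i; simp [hΓ0]
  · funext i
    have := Real.pi_ne_zero
    simp [hv]
  · funext i
    have := Real.pi_ne_zero
    rw [← congrFun (hΓ i) t]
    simp only [torusExp, ContinuousMap.coe_mk, Path.coe_mk_mk, Function.comp_apply]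
    congr 1
    field_simp

variable {X : Type*} [TopologicalSpace X] [MulAction (Torus d) X] [ContinuousSMul (Torus d) X]

/-- The loop `t ↦ exp (2πi t v) • x` in the orbit of `x`. -/
noncomputable def torusLoop (x : X) (v : Fin d → ℤ) : Path x x where
  toFun t := torusExp d (fun i => (t : ℝ) * v i) • x
  continuous_toFun := by fun_prop
  source' := by
    have : torusExp d (fun i => ((0 : I) : ℝ) * v i) = 1 := by
      rw [← torusExp_zero]; congr 1; funext i; simp
    rw [this, one_smul]
  target' := by
    have : torusExp d (fun i => ((1 : I) : ℝ) * v i) = 1 := by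
      rw [← torusExp_intCast v]; congr 1; funext i; simp
    rw [this, one_smul]

theorem torusLoop_apply (x : X) (v : Fin d → ℤ) (t : I) :
    torusLoop x v t = torusExp d (fun i => (t : ℝ) * v i) • x := rfl

variable (X) in
/-- The map `ℝ^d → X` covering the orbit of `x`. -/
noncomputable def torusExpSMul (x : X) : C(Fin d → ℝ, X) :=
  ⟨fun u => torusExp d u • x, by fun_prop⟩

/-- The straight path from `u` to `u + v`. -/
noncomputable def straightPath (u v : Fin d → ℝ) : Path u (u + v) where
  toFun t := fun i => u i + (t : ℝ) * v i
  continuous_toFun := by fun_prop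
  source' := by funext i; simp
  target' := by funext i; simp

theorem torusLoop_eq_straightPath (x : X) (u v : Fin d → ℤ) (t : I) :
    torusLoop x v t =
      torusExpSMul X x (straightPath (fun i => (u i : ℝ)) (fun i => (v i : ℝ)) t) := by
  have : (straightPath (fun i => (u i : ℝ)) (fun i => (v i : ℝ)) t) =
      (fun i => (u i : ℝ)) + fun i => (t : ℝ) * v i := rfl
  rw [this, torusExpSMul, ContinuousMap.coe_mk, torusExp_add, torusExp_intCast, one_mul]
  rfl

/-- Both sides are images of paths from 0 to u + v in the simply connected ℝ^d. -/
theorem torusLoop_add_homotopic (x : X) (u v : Fin d → ℤ) :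
    (torusLoop x (u + v)).Homotopic ((torusLoop x u).trans (torusLoop x v)) := by
  let cu : Fin d → ℝ := fun i => (u i : ℝ)
  let cv : Fin d → ℝ := fun i => (v i : ℝ)
  have e0 : (fun i => ((0 : Fin d → ℤ) i : ℝ)) = (0 : Fin d → ℝ) := by funext i; simp
  have huv : (0 : Fin d → ℝ) + (cu + cv) = 0 + cu + cv := (add_assoc _ _ _).symm
  refine Path.homotopic_of_comp (torusExpSMul X x) ((straightPath 0 (cu + cv)).cast rfl huv.symm)
    ((straightPath 0 cu).trans (straightPath (0 + cu) cv)) _ _ (fun t => ?_) (fun t => ?_)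
  · rw [torusLoop_eq_straightPath x 0, e0, Path.cast_coe]
    have e1 : (fun i => ((u + v) i : ℝ)) = cu + cv := by funext i; simp [cu, cv]
    rw [e1]
  · rw [Path.trans_apply, Path.trans_apply]
    split_ifs with h
    · rw [torusLoop_eq_straightPath x 0, e0]
    · rw [torusLoop_eq_straightPath x u]
      have : (0 : Fin d → ℝ) + cu = cu := zero_add _
      simp only [straightPath, Path.coe_mk_mk, this]
      rfl

/-- A vector of `ℤ^d` whose one-parameter subgroup fixes a point in the path component of `x`
gives a null-homotopic loop at `x`. -/
theorem torusLoop_homotopic_refl {x y : X} (h : Joined x y) {v : Fin d → ℤ}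
    (hv : ∀ s, oneParam v s • y = y) : (torusLoop x v).Homotopic (Path.refl x) := by
  obtain ⟨p⟩ := h
  let K : C(I × I, X) := ⟨fun z => torusExp d (fun i => (z.2 : ℝ) * v i) • p z.1, by fun_prop⟩
  let L : C(I × I, X) := ⟨fun z => p z.1, by fun_prop⟩
  refine Path.homotopic_of_squares K L (fun t => ?_) (fun s => ?_) (fun s => ?_) _ _
    (fun t => ?_) (fun t => ?_)
  · simp [K, L, torusExp_mul_intCast, hv]
  · simp [K, L, torusExp_mul_intCast]
  · have : Circle.exp (2 * Real.pi) = 1 := Circle.exp_two_pi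
    simp [K, L, torusExp_mul_intCast, this]
  · simp [K, torusLoop_apply]
  · simp [L]

/-- If the stabilizer of `x` is path connected then every loop induced by a path in the torus is
homotopic to some `torusLoop`. -/
theorem exists_homotopic_torusLoop {x : X}
    (hx : ∀ h : Torus d, h • x = x → JoinedIn {t : Torus d | t • x = x} 1 h) {γ : Path x x}
    (hγ : γ.IsOrbitPath (Torus d)) : ∃ v : Fin d → ℤ, γ.Homotopic (torusLoop x v) := by
  obtain ⟨g, g0, hg⟩ := hγ
  obtain ⟨s, hs⟩ := hx (g 1) (by rw [← hg]; exact γ.target)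
  -- Dividing g by the stabilizer path s closes it up to a loop without changing its action on x.
  obtain ⟨v, G, hG⟩ := exists_lift_torusExp (⟨fun t => g t * (s t)⁻¹, by fun_prop⟩ : C(I, Torus d))
    (by simp [g0]) (by simp)
  refine ⟨v, Path.homotopic_of_comp (torusExpSMul X x) G
    ((straightPath 0 (fun i => (v i : ℝ))).cast rfl (zero_add _).symm) _ _ (fun t => ?_)
    (fun t => ?_)⟩
  · have : (s t)⁻¹ • x = x := inv_smul_eq_iff.2 (hs t).symm
    rw [torusExpSMul, ContinuousMap.coe_mk, hG, ContinuousMap.coe_mk, mul_smul, this, hg]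
  · have e0 : (fun i => ((0 : Fin d → ℤ) i : ℝ)) = (0 : Fin d → ℝ) := by funext i; simp
    rw [torusLoop_eq_straightPath x 0, e0]
    rfl

/-- The homomorphism `ℤ^d = π₁(T^d) → π₁(X)` induced by an orbit map. -/
noncomputable def orbitHom (x : X) : Multiplicative (Fin d → ℤ) →* FundamentalGroup X x :=
  MonoidHom.mk' (fun v => Path.Homotopic.Quotient.mk (torusLoop x v.toAdd)) fun u v => by
    -- The group law concatenates in the opposite order; commutativity of ℤ^d absorbs this.
    rw [FundamentalGroup.mul_def, mul_comm]
    exact Path.Homotopic.Quotient.eq.2 (torusLoop_add_homotopic x _ _)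

end TorusLoops

/-! ### Quotients of ℤ^d by full-rank sublattices -/

theorem finite_quotient_of_finrank_eq {d : ℕ} (L : Submodule ℤ (Fin d → ℤ))
    (hL : Module.finrank ℤ L = d) : Finite ((Fin d → ℤ) ⧸ L) := by
  apply Module.finite_of_fg_torsion
  rw [← Module.finrank_eq_zero_iff_isTorsion]
  have := L.finrank_quotient_add_finrank
  rw [hL, Module.finrank_fin_fun] at this
  omega

theorem finite_of_surjective_of_span {d m : ℕ} {G : Type*} [Group G]
    (f : Multiplicative (Fin d → ℤ) →* G) (hf : Function.Surjective f)
    (lam : Fin m → Fin d → ℤ) (hlam : ∀ i, f (.ofAdd (lam i)) = 1) (hrank : charRank lam = d) :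
    Finite G ∧ ∀ g h : G, g * h = h * g := by
  refine ⟨?_, fun g h => ?_⟩
  · let L := Submodule.span ℤ (Set.range lam)
    have := finite_quotient_of_finrank_eq L hrank
    have hker : ∀ v ∈ L, f (.ofAdd v) = 1 := fun v hv => by
      induction hv using Submodule.span_induction with
      | mem v hv => obtain ⟨i, rfl⟩ := hv; exact hlam i
      | zero => exact map_one f
      | add u v _ _ hu hv => rw [ofAdd_add, map_mul, hu, hv, one_mul]
      | smul n v _ hv => rw [ofAdd_zsmul, map_zpow, hv, one_zpow]
    have hout : ∀ v, f (.ofAdd ((L.mkQ v).out)) = f (.ofAdd v) := fun v => by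
      have : L.mkQ (L.mkQ v).out = L.mkQ v := Quotient.out_eq _
      rw [← sub_eq_zero, ← map_sub, Submodule.mkQ_apply, Submodule.Quotient.mk_eq_zero] at this
      have := hker _ this
      rwa [ofAdd_sub, map_div, div_eq_one] at this
    refine Finite.of_surjective (fun c : (Fin d → ℤ) ⧸ L => f (.ofAdd c.out)) fun g => ?_
    obtain ⟨v, rfl⟩ := hf g
    exact ⟨L.mkQ v.toAdd, hout _⟩
  · obtain ⟨u, rfl⟩ := hf g
    obtain ⟨v, rfl⟩ := hf h
    rw [← map_mul, mul_comm, map_mul]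

/-! ### Radial retraction in the standard model -/

/-- The direction of a complex number, with `1` as the direction of `0`. -/
noncomputable def circleDir (w : ℂ) : Circle := Circle.exp w.arg

theorem norm_mul_circleDir (w : ℂ) : (‖w‖ : ℂ) * circleDir w = w := by
  rw [circleDir, Circle.coe_exp, Complex.norm_mul_exp_arg_mul_I]

/-- Although `Complex.arg` jumps on the negative axis, the direction is w / ‖w‖ away from 0. -/
theorem continuousOn_circleDir : ContinuousOn circleDir {w | w ≠ 0} := by
  have hind : Topology.IsInducing (fun z : Circle => (z : ℂ)) := Topology.IsInducing.subtypeVal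
  rw [hind.continuousOn_iff]
  have : ContinuousOn (fun w : ℂ => w / (‖w‖ : ℂ)) {w | w ≠ 0} :=
    continuousOn_id.div (by fun_prop) fun w hw => by simpa using hw
  refine this.congr fun w hw => ?_
  rw [Function.comp_apply]
  have h0 : (‖w‖ : ℂ) ≠ 0 := by simpa using hw
  rw [eq_div_iff h0, mul_comm]
  exact norm_mul_circleDir w

section StdSpace

variable {n k : ℕ}

theorem stdAct_append (a : Fin n → Circle) (b : Fin k → Circle) (z : StdSpace n k) :
    stdAct (Fin.append a b) z = (fun i => (a i : ℂ) * z.1 i, fun j => b j * z.2 j) := by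
  simp [stdAct]

theorem norm_stdAct (t : Torus (n + k)) (z : StdSpace n k) (i : Fin n) :
    ‖(stdAct t z).1 i‖ = ‖z.1 i‖ := by
  simp [stdAct, Circle.norm_coe]

/-- The points of `ℂⁿ × T^k` whose radii differ from those of `z` by less than `ε`. -/
def radialBox (z : StdSpace n k) (ε : ℝ) : Set (StdSpace n k) :=
  {w | ∀ i, |‖w.1 i‖ - ‖z.1 i‖| < ε}

theorem isOpen_radialBox (z : StdSpace n k) (ε : ℝ) : IsOpen (radialBox z ε) := by
  simp only [radialBox, Set.ofPred_forall]
  exact isOpen_iInter_of_finite fun i => isOpen_lt (by fun_prop) continuous_const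

/-- An invariant set is determined by the radii of its points. Pulling O back along the slice with
the phases of z gives ε; a rotation moves the slice point to w. -/
theorem exists_radialBox_subset {O : Set (StdSpace n k)} (hO : IsOpen O)
    (hinv : ∀ t, ∀ w ∈ O, stdAct t w ∈ O) {z : StdSpace n k} (hz : z ∈ O) :
    ∃ ε > 0, radialBox z ε ⊆ O := by
  let f : (Fin n → ℝ) → StdSpace n k := fun r => (fun i => (r i : ℂ) * circleDir (z.1 i), z.2)
  have hf : Continuous f := by fun_prop
  have hfz : f (fun i => ‖z.1 i‖) = z :=
    Prod.ext (funext fun i => norm_mul_circleDir _) rfl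
  obtain ⟨ε, hε, hball⟩ := Metric.isOpen_iff.1 (hO.preimage hf) (fun i => ‖z.1 i‖)
    (by rw [Set.mem_preimage, hfz]; exact hz)
  refine ⟨ε, hε, fun w hw => ?_⟩
  have hw' : f (fun i => ‖w.1 i‖) ∈ O := hball <| by
    rw [Metric.mem_ball, dist_pi_lt_iff hε]
    exact hw
  convert hinv (Fin.append (fun i => circleDir (w.1 i) / circleDir (z.1 i))
    (fun j => w.2 j / z.2 j)) _ hw'
  rw [stdAct_append]
  refine Prod.ext (funext fun i => ?_) (funext fun j => ?_)
  · have h0 : (circleDir (z.1 i) : ℂ) ≠ 0 := Circle.coe_ne_zero _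
    conv_lhs => rw [← norm_mul_circleDir (w.1 i)]
    simp only [f, Circle.coe_div]
    field_simp
  · simp [f]

/-- The equivariant radial deformation of a neighbourhood of the orbit of `z` onto this orbit. -/
noncomputable def radialFlow (z : StdSpace n k) (s : ℝ) (w : StdSpace n k) : StdSpace n k :=
  (fun i => (((1 - s) + s * (‖z.1 i‖ / ‖w.1 i‖) : ℝ) : ℂ) * w.1 i, w.2)

theorem radialFlow_zero (z w : StdSpace n k) : radialFlow z 0 w = w := by
  simp [radialFlow]

theorem radialFlow_stdAct (z : StdSpace n k) (s : ℝ) (t : Torus (n + k)) (w : StdSpace n k) :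
    radialFlow z s (stdAct t w) = stdAct t (radialFlow z s w) := by
  refine Prod.ext (funext fun i => ?_) rfl
  simp only [radialFlow, norm_stdAct]
  simp only [stdAct]
  ring

/-- The flow interpolates radii linearly, so each deviation from ‖z i‖ is scaled by 1 - s. -/
theorem radialFlow_mem {z w : StdSpace n k} {ε : ℝ} (hw : w ∈ radialBox z ε)
    (hzw : ∀ i, z.1 i ≠ 0 → w.1 i ≠ 0) (s : I) : radialFlow z s w ∈ radialBox z ε := by
  intro i
  by_cases h : w.1 i = 0
  · have : z.1 i = 0 := by_contra fun hz => hzw i hz h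
    simpa [radialFlow, this, h] using hw i
  · have h0 : ‖w.1 i‖ ≠ 0 := by simpa using h
    have hs := s.2
    have key : ‖(radialFlow z s w).1 i‖ - ‖z.1 i‖ = (1 - s) * (‖w.1 i‖ - ‖z.1 i‖) := by
      have : 0 ≤ (1 - (s : ℝ)) + s * (‖z.1 i‖ / ‖w.1 i‖) :=
        add_nonneg (by linarith [hs.2]) (mul_nonneg hs.1 (by positivity))
      simp only [radialFlow, norm_mul, Complex.norm_real, Real.norm_eq_abs, abs_of_nonneg this]
      field_simp
      ring
    rw [key, abs_mul, abs_of_nonneg (by linarith [hs.2])]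
    exact lt_of_le_of_lt (mul_le_of_le_one_left (abs_nonneg _) (by linarith [hs.1])) (hw i)

/-- Where z i = 0 the factor is just 1 - s, so a vanishing w i causes no trouble; elsewhere w i
stays nonzero on B. -/
theorem continuousOn_radialFlow {z : StdSpace n k} {B : Set (StdSpace n k)}
    (hB : ∀ w ∈ B, ∀ i, z.1 i ≠ 0 → w.1 i ≠ 0) :
    ContinuousOn (fun p : I × StdSpace n k => radialFlow z p.1 p.2) (Set.univ ×ˢ B) := by
  refine ContinuousOn.prodMk (continuousOn_pi.2 fun i => ?_) (by fun_prop)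
  by_cases h : z.1 i = 0
  · simp only [h, norm_zero, zero_div, mul_zero, add_zero]
    fun_prop
  · have h1 : ContinuousOn (fun p : I × StdSpace n k => ‖z.1 i‖ / ‖p.2.1 i‖) (Set.univ ×ˢ B) :=
      continuousOn_const.div (by fun_prop) fun p hp => by simpa using hB p.2 hp.2 i h
    have h2 : ContinuousOn (fun p : I × StdSpace n k =>
        (1 - (p.1 : ℝ)) + p.1 * (‖z.1 i‖ / ‖p.2.1 i‖)) (Set.univ ×ˢ B) :=
      ContinuousOn.add (by fun_prop) (ContinuousOn.mul (by fun_prop) h1)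
    exact (Complex.continuous_ofReal.comp_continuousOn h2).mul (by fun_prop)

open Classical in
/-- The element of the torus moving `z` to the end point of the radial flow line of `w`. -/
noncomputable def phase (z w : StdSpace n k) : Torus (n + k) :=
  Fin.append (fun i => if z.1 i = 0 then 1 else circleDir (w.1 i) / circleDir (z.1 i))
    (fun j => w.2 j / z.2 j)

theorem radialFlow_one {z w : StdSpace n k} (hzw : ∀ i, z.1 i ≠ 0 → w.1 i ≠ 0) :
    radialFlow z 1 w = stdAct (phase z w) z := by
  rw [phase, stdAct_append]
  refine Prod.ext (funext fun i => ?_) (funext fun j => by simp [radialFlow])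
  by_cases h : z.1 i = 0
  · simp [radialFlow, h]
  · have h0 : (circleDir (z.1 i) : ℂ) ≠ 0 := Circle.coe_ne_zero _
    have h1 : (‖w.1 i‖ : ℂ) ≠ 0 := by simpa using hzw i h
    simp only [radialFlow, if_neg h, Circle.coe_div]
    push_cast
    field_simp
    linear_combination w.1 i * norm_mul_circleDir (z.1 i) - z.1 i * norm_mul_circleDir (w.1 i)

theorem continuousOn_phase {z : StdSpace n k} {B : Set (StdSpace n k)}
    (hB : ∀ w ∈ B, ∀ i, z.1 i ≠ 0 → w.1 i ≠ 0) : ContinuousOn (phase z) B := by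
  refine continuousOn_pi.2 fun l => ?_
  induction l using Fin.addCases with
  | left i =>
    simp only [phase, Fin.append_left]
    by_cases h : z.1 i = 0
    · simp only [if_pos h]
      exact continuousOn_const
    · simp only [if_neg h]
      exact (continuousOn_circleDir.comp (by fun_prop) fun w hw => hB w hw i h).div'
        continuousOn_const
  | right j =>
    simp only [phase, Fin.append_right]
    fun_prop

/-- Stabilizers of the standard action are path connected. -/
theorem exists_path_stdAct_eq {z : StdSpace n k} {h : Torus (n + k)} (hz : stdAct h z = z) :
    ∃ p : Path 1 h, ∀ s, stdAct (p s) z = z := by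
  refine ⟨⟨⟨fun s l => Circle.exp (s * Complex.arg (h l)), by fun_prop⟩, ?_, ?_⟩, fun s => ?_⟩
  · funext l; simp
  · funext l; simp
  · refine Prod.ext (funext fun i => ?_) (funext fun j => ?_)
    · by_cases hi : z.1 i = 0
      · simp [stdAct, hi]
      · have h1 : (h (Fin.castAdd k i) : ℂ) = 1 :=
          mul_right_cancel₀ hi ((congrFun (congrArg Prod.fst hz) i).trans (one_mul _).symm)
        simp [stdAct, h1]
    · have h1 : h (Fin.natAdd n j) = 1 :=
        mul_eq_right.1 (congrFun (congrArg Prod.snd hz) j)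
      simp [stdAct, h1]

end StdSpace

/-! ### Tubes in standard charts -/

section Charts

variable {n k : ℕ} {M : Type*} [TopologicalSpace M]
  [ChartedSpace (EuclideanSpace ℝ (Fin (2 * n + k))) M] [MulAction (Torus (n + k)) M]

theorem StdChart.stdAct_mem_target (c : StdChart n k M) (t : Torus (n + k)) {w : StdSpace n k}
    (hw : w ∈ c.toHomeo.target) : stdAct t w ∈ c.toHomeo.target ∧
      c.toHomeo.symm (stdAct t w) = c.θ.symm t • c.toHomeo.symm w := by
  have hx := c.toHomeo.map_target hw
  have hmem := c.smul_mem (c.θ.symm t) _ hx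
  have h := c.map_smul (c.θ.symm t) _ hx
  rw [c.toHomeo.right_inv hw, ContinuousMulEquiv.apply_symm_apply] at h
  rw [← h]
  exact ⟨c.toHomeo.map_source hmem, c.toHomeo.left_inv hmem⟩

theorem StdChart.joinedIn_stabilizer (c : StdChart n k M) {x : M} (hx : x ∈ c.toHomeo.source)
    {h : Torus (n + k)} (hh : h • x = x) :
    JoinedIn {t : Torus (n + k) | t • x = x} 1 h := by
  obtain ⟨p, hp⟩ := exists_path_stdAct_eq (h := c.θ h) (z := c.toHomeo x)
    (by rw [← c.map_smul h x hx, hh])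
  refine ⟨(p.map (f := c.θ.symm) c.θ.symm.continuous).cast (map_one c.θ.symm).symm
    (c.θ.symm_apply_apply h).symm, fun s => ?_⟩
  refine c.toHomeo.injOn (c.smul_mem _ _ hx) hx ?_
  rw [c.map_smul _ _ hx]
  simpa using hp s

/-- In a standard chart every orbit has arbitrarily small tubes. -/
theorem StdChart.exists_isTube (c : StdChart n k M) {x : M} (hx : x ∈ c.toHomeo.source)
    {W : Set M} (hW : IsOpen W) (hxW : x ∈ W)
    (hinv : ∀ t : Torus (n + k), ∀ w ∈ W, t • w ∈ W) :
    ∃ U, IsTube (Torus (n + k)) U ∧ x ∈ U ∧ U ⊆ W := by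
  let z := c.toHomeo x
  have hzt : z ∈ c.toHomeo.target := c.toHomeo.map_source hx
  -- Beyond fitting into the chart and W, coordinates nonzero at z must stay nonzero, so that the
  -- flow and the phase are continuous.
  let O : Set (StdSpace n k) := (c.toHomeo.target ∩ c.toHomeo.symm ⁻¹' W) ∩
    {w | ∀ i, z.1 i ≠ 0 → w.1 i ≠ 0}
  have hO : IsOpen O := by
    refine (c.toHomeo.isOpen_inter_preimage_symm hW).inter ?_
    simp only [Set.ofPred_forall]
    exact isOpen_iInter_of_finite fun i => isOpen_iInter_of_finite fun _ =>
      isOpen_ne_fun (by fun_prop) continuous_const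
  have hOinv : ∀ t, ∀ w ∈ O, stdAct t w ∈ O := by
    rintro t w ⟨⟨hw, hwW⟩, hzw⟩
    obtain ⟨h1, h2⟩ := c.stdAct_mem_target t hw
    refine ⟨⟨h1, ?_⟩, fun i hi => mul_ne_zero (Circle.coe_ne_zero _) (hzw i hi)⟩
    rw [Set.mem_preimage, h2]
    exact hinv _ _ hwW
  have hzO : z ∈ O := ⟨⟨hzt, by rwa [Set.mem_preimage, c.toHomeo.left_inv hx]⟩, fun _ h => h⟩
  obtain ⟨ε, hε, hBO⟩ := exists_radialBox_subset hO hOinv hzO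
  let B := radialBox z ε
  have hBne : ∀ w ∈ B, ∀ i, z.1 i ≠ 0 → w.1 i ≠ 0 := fun w hw => (hBO hw).2
  let U : Set M := c.toHomeo.source ∩ c.toHomeo ⁻¹' B
  have hUcont : ContinuousOn c.toHomeo U := c.toHomeo.continuousOn.mono Set.inter_subset_left
  have hflow : ∀ (s : I), ∀ w ∈ B, radialFlow z s w ∈ B := fun s w hw =>
    radialFlow_mem hw (hBne w hw) s
  refine ⟨U, ⟨c.toHomeo.isOpen_inter_preimage (isOpen_radialBox z ε), ?_, x,
    fun h hh => c.joinedIn_stabilizer hx hh,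
    fun p => c.toHomeo.symm (radialFlow z p.1 (c.toHomeo p.2)),
    fun u => c.θ.symm (phase z (c.toHomeo u)), ?_, ?_, ?_, ?_, ?_, ?_⟩, ⟨hx, ?_⟩, ?_⟩
  · rintro t u ⟨hu, huB⟩
    refine ⟨c.smul_mem t u hu, fun i => ?_⟩
    rw [c.map_smul t u hu, norm_stdAct]
    exact huB i
  · refine c.toHomeo.symm.continuousOn.comp ((continuousOn_radialFlow hBne).comp
      (f := fun p : I × M => (p.1, c.toHomeo p.2)) ?_ fun p hp => ⟨trivial, hp.2.2⟩)
      fun p hp => (hBO (hflow p.1 _ hp.2.2)).1.1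
    exact continuousOn_fst.prodMk (hUcont.comp continuousOn_snd fun p hp => hp.2)
  · exact c.θ.symm.continuous.comp_continuousOn
      ((continuousOn_phase hBne).comp hUcont fun u hu => hu.2)
  · rintro u ⟨hu, -⟩
    simp only [Set.Icc.coe_zero, radialFlow_zero]
    exact c.toHomeo.left_inv hu
  · rintro u ⟨hu, huB⟩
    simp only [Set.Icc.coe_one]
    rw [radialFlow_one (hBne _ huB), (c.stdAct_mem_target _ hzt).2, c.toHomeo.left_inv hx]
  · rintro s u ⟨hu, huB⟩
    have h := hBO (hflow s _ huB)
    refine ⟨c.toHomeo.map_target h.1.1, ?_⟩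
    rw [Set.mem_preimage, c.toHomeo.right_inv h.1.1]
    exact hflow s _ huB
  · rintro s u ⟨hu, huB⟩ t
    have h := hBO (hflow s _ huB)
    simp only
    rw [c.map_smul t u hu, radialFlow_stdAct, (c.stdAct_mem_target _ h.1.1).2]
    simp
  · exact fun i => by simpa [z] using hε
  · rintro u ⟨hu, huB⟩
    have := (hBO huB).1.2
    rwa [Set.mem_preimage, c.toHomeo.left_inv hu] at this

end Charts

/-! ### The polytope and the conclusion -/

theorem SimplePolytope.isCompact_carrier {n m : ℕ} (P : SimplePolytope n m) :
    IsCompact P.carrier := by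
  refine Metric.isCompact_of_isClosed_isBounded ?_ P.bounded
  simp only [SimplePolytope.carrier, polyhedron, Set.ofPred_forall]
  exact isClosed_iInter fun i => isClosed_le continuous_const (by fun_prop)

theorem SimplePolytope.convex_carrier {n m : ℕ} (P : SimplePolytope n m) :
    Convex ℝ P.carrier := by
  simp only [SimplePolytope.carrier, polyhedron, Set.ofPred_forall]
  refine convex_iInter fun i => ?_
  intro x hx y hy a b ha hb hab
  simp only [Set.mem_ofPred_eq, inner_add_right, inner_smul_right] at *
  have : a * inner ℝ (P.a i) x + b * inner ℝ (P.a i) y + P.b i =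
      a * (inner ℝ (P.a i) x + P.b i) + b * (inner ℝ (P.a i) y + P.b i) := by
    linear_combination (-P.b i) * hab
  rw [this]
  positivity

theorem lemma2p4 (n k m : ℕ) (M : Type*) [TopologicalSpace M] [T2Space M]
    [SecondCountableTopology M] [ChartedSpace (EuclideanSpace ℝ (Fin (2 * n + k))) M]
    [IsManifold (𝓡 (2 * n + k)) ∞ M] [MulAction (Torus (n + k)) M]
    (hM : IsLocallyStandard n k M)
    (P : SimplePolytope n m) (q : M → P.carrier) (hq : IsOrbitMap (k := k) P q)
    (lam : Fin m → (Fin (n + k) → ℤ)) (hlam : IsCharacteristicFunction P q lam)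
    (hrank : charRank lam = n + k) (x : M) :
    Finite (FundamentalGroup M x) ∧ ∀ g h : FundamentalGroup M x, g * h = h * g := by
  have : ContinuousSMul (Torus (n + k)) M :=
    ⟨hM.smooth_action.contMDiff_smul.continuous⟩
  have htube : ∀ y (W : Set M), IsOpen W → y ∈ W → (∀ t : Torus (n + k), ∀ w ∈ W, t • w ∈ W) →
      ∃ U, IsTube (Torus (n + k)) U ∧ y ∈ U ∧ U ⊆ W := fun y W hW hyW hinv => by
    obtain ⟨c, hc⟩ := hM.locally_standard y
    exact c.exists_isTube hc hW hyW hinv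
  have : PathConnectedSpace (Torus (n + k)) :=
    (torusExp_surjective _).pathConnectedSpace (torusExp (n + k)).continuous
  refine finite_of_surjective_of_span (orbitHom x) (fun γ => ?_) lam (fun i => ?_) hrank
  · obtain ⟨γ, rfl⟩ := Path.Homotopic.Quotient.mk_surjective γ
    obtain ⟨ε, hε, hγε⟩ := exists_homotopic_isOrbitPath_of_tubes P.isCompact_carrier
      P.convex_carrier hq.isQuotientMap hq.fiber htube γ rfl
    obtain ⟨c, hc⟩ := hM.locally_standard x
    obtain ⟨v, hv⟩ := exists_homotopic_torusLoop (fun h => c.joinedIn_stabilizer hc) hε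
    exact ⟨.ofAdd v, Path.Homotopic.Quotient.eq.2 (hγε.trans hv).symm⟩
  -- A point y over F_i is fixed by the circle of λ(F_i), which kills the corresponding loop at x.
  · obtain ⟨p, hp⟩ := P.facet_nonempty i
    obtain ⟨y, hy⟩ := hq.isQuotientMap.surjective ⟨p, hp.1⟩
    have hyi : (q y : EuclideanSpace ℝ (Fin n)) ∈ P.facet i := by rw [hy]; exact hp
    refine Path.Homotopic.Quotient.eq.2 (torusLoop_homotopic_refl
      (joined_of_tubes P.isCompact_carrier P.convex_carrier hq.isQuotientMap hq.fiber htube x y)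
      fun s => ?_)
    have hs : oneParam (lam i) s ∈ (oneParam (lam i)).range := ⟨s, rfl⟩
    rw [← (hlam i).2] at hs
    exact (mem_fixingSubgroup_iff _).1 hs y hyi
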